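/- For real parameters let ${}_3F_2(a,b,c;d,e;z)$ denote the analytic continuation to $\mathbb{C}\setminus[1,\infty)$ of the series $\sum_{n\ge 0}\frac{(a)_n(b)_n(c)_n}{(d)_n(e)_n\,n!}z^n$, $|z|<1$, where $(a)_n=a(a+1)\cdots(a+n-1)$. Suppose that $d+e-b-c>0$, $b>0$, $c>0$ and $\min(b,c)<\min(d,e)$. (1) Let $a\in\mathbb{R}$ and $\delta>0$. The analytic continuations ${}_3F_2(a,b,c;d,e;z)$ and ${}_3F_2(a,b+\delta,c+\delta;d+\delta,e+\delta;z)$ exist, ${}_3F_2(a,b,c;d,e;-x)\neq 0$ for all $x>-1$, and the function $$x\mapsto \frac{{}_3F_2(a,b+\delta,c+\delta;d+\delta,e+\delta;-x)}{{}_3F_2(a,b,c;d,e;-x)}$$ is strictly decreasing on $(-1,\infty)$ if $a>0$ and strictly increasing on $(-1,\infty)$ if $a<0$. (2) For all $x>0$, $$\frac{1}{1+x\,\frac{bc}{de}}<{}_3F_2(1,b,c;d,e;-x),$$ and if moreover $b>1$ and $c>1$, then also $${}_3F_2(1,b,c;d,e;-x)<\frac{1}{1+x\,\frac{(b-1)(c-1)}{(d-1)(e-1)}}.$$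 (3) For all $\sigma\ge 1$ and all $x>-1$ with $x\ne 0$, $$\frac{1}{\left(1+x\,\frac{bc}{de}\right)^{\sigma}}<{}_3F_2(\sigma,b,c;d,e;-x).$$ (4) If moreover $b>1$ and $c>1$, then for all $0<\sigma\le 1$ and all $x>0$, $${}_3F_2(\sigma,b,c;d,e;-x)<\frac{1}{\left(1+x\,\frac{(b-1)(c-1)}{(d-1)(e-1)}\right)^{\sigma}}.$$ -/

import Mathlib

/-- The `n`-th Maclaurin coefficient `(a)ₙ (b)ₙ (c)ₙ / ((d)ₙ (e)ₙ n!)` of `₃F₂(a, b, c; d, e; z)`. -/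
noncomputable def hyp3F2Coeff (a b c d e : ℝ) (n : ℕ) : ℝ :=
  ((ascPochhammer ℝ n).eval a * (ascPochhammer ℝ n).eval b * (ascPochhammer ℝ n).eval c) /
    ((ascPochhammer ℝ n).eval d * (ascPochhammer ℝ n).eval e * (n.factorial : ℝ))

/-- The complex plane cut along `[1, ∞)`. -/
def cutPlane : Set ℂ := {z | 1 - z ∈ Complex.slitPlane}

/-- `F` is holomorphic on `ℂ \ [1, ∞)` and is the sum of the series `₃F₂(a, b, c; d, e; z)` in the
open unit disc. -/
structure IsHyp3F2 (a b c d e : ℝ) (F : ℂ → ℂ) : Prop where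
  differentiableOn : DifferentiableOn ℂ F cutPlane
  hasSum : ∀ z : ℂ, ‖z‖ < 1 → HasSum (fun n : ℕ => (hyp3F2Coeff a b c d e n : ℂ) * z ^ n) (F z)

open Classical in
/-- The generalized hypergeometric function `₃F₂(a, b, c; d, e; z)` with real parameters: the
analytic continuation of the series to `ℂ \ [1, ∞)` (and `0` if there is none). -/
noncomputable def hyp3F2 (a b c d e : ℝ) : ℂ → ℂ :=
  if h : ∃ F, IsHyp3F2 a b c d e F then h.choose else 0

/-- The values of `₃F₂(a, b, c; d, e; x)` at real `x`; for `x < 1` they are real, see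
`hyp3F2_ofReal`. -/
noncomputable def realHyp3F2 (a b c d e x : ℝ) : ℝ := (hyp3F2 a b c d e (x : ℂ)).re

theorem isOpen_cutPlane : IsOpen cutPlane :=
  Complex.isOpen_slitPlane.preimage (by fun_prop)

theorem ofReal_mem_cutPlane {x : ℝ} (hx : x < 1) : (x : ℂ) ∈ cutPlane := by
  simp [cutPlane, Complex.mem_slitPlane_iff, hx]

theorem isPreconnected_cutPlane : IsPreconnected cutPlane := by
  have h : cutPlane = (fun w : ℂ => 1 - w) '' Complex.slitPlane := by
    ext z
    simp only [cutPlane, Set.mem_ofPred_eq, Set.mem_image]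
    constructor
    · intro h
      exact ⟨1 - z, h, by ring⟩
    · rintro ⟨w, hw, rfl⟩
      simpa using hw
  rw [h]
  exact (Complex.starConvex_one_slitPlane.isPathConnected
    Complex.one_mem_slitPlane).isConnected.isPreconnected.image _
    (by fun_prop)

/-- The analytic continuation is unique. -/
theorem IsHyp3F2.eqOn {a b c d e : ℝ} {F G : ℂ → ℂ} (hF : IsHyp3F2 a b c d e F)
    (hG : IsHyp3F2 a b c d e G) : Set.EqOn F G cutPlane := by
  refine (hF.differentiableOn.analyticOnNhd isOpen_cutPlane).eqOn_of_preconnected_of_eventuallyEq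
    (hG.differentiableOn.analyticOnNhd isOpen_cutPlane) isPreconnected_cutPlane
    (z₀ := 0) (by simpa using ofReal_mem_cutPlane (x := 0) one_pos) ?_
  filter_upwards [Metric.ball_mem_nhds (0 : ℂ) one_pos] with z hz
  have hz' : ‖z‖ < 1 := by simpa using hz
  exact (hF.hasSum z hz').unique (hG.hasSum z hz')

theorem isHyp3F2_hyp3F2 {a b c d e : ℝ} (h : ∃ F, IsHyp3F2 a b c d e F) :
    IsHyp3F2 a b c d e (hyp3F2 a b c d e) := by
  rw [hyp3F2, dif_pos h]
  exact h.choose_spec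

theorem IsHyp3F2.conj {a b c d e : ℝ} {F : ℂ → ℂ} (hF : IsHyp3F2 a b c d e F) :
    IsHyp3F2 a b c d e (fun z => (starRingEnd ℂ) (F ((starRingEnd ℂ) z))) where
  differentiableOn := by
    intro z hz
    have hz' : (starRingEnd ℂ) z ∈ cutPlane := by
      simpa [cutPlane, Complex.mem_slitPlane_iff] using hz
    have h := (hF.differentiableOn.differentiableAt (isOpen_cutPlane.mem_nhds hz'))
    have h2 := h.conj_conj
    simp only [Complex.conj_conj] at h2
    exact h2.differentiableWithinAt
  hasSum := by
    intro z hz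
    have h := hF.hasSum ((starRingEnd ℂ) z) (by simpa using hz)
    have h2 := h.map (starRingEnd ℂ) Complex.continuous_conj
    convert h2 using 1
    ext n
    simp

/-- On `(-∞, 1)` the function `₃F₂` is real. -/
theorem hyp3F2_ofReal (a b c d e : ℝ) {x : ℝ} (hx : x < 1) :
    hyp3F2 a b c d e (x : ℂ) = (realHyp3F2 a b c d e x : ℂ) := by
  by_cases h : ∃ F, IsHyp3F2 a b c d e F
  · have hF := isHyp3F2_hyp3F2 h
    have := hF.conj.eqOn hF (ofReal_mem_cutPlane hx)
    simp only [Complex.conj_ofReal] at this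
    exact (Complex.conj_eq_iff_re.mp this).symm
  · simp [realHyp3F2, hyp3F2, dif_neg h]

/-! The quotient Γ(b+t)Γ(c+t)/(Γ(d+t)Γ(e+t)) is the Mellin transform of a positive atomless measure
ρ on (0, 1) (`exists_isMomentMeasure`). Expanding (1 - zs)^(-a) binomially identifies ₃F₂(a, b, c;
d, e; z) with a multiple of ∫ (1 - zs)^(-a) dρ(s), which is holomorphic off [1, ∞). Shifting b, c,
d, e by δ only inserts the weight s^δ (`isHyp3F2_stieltjes`).

The ratio in (1) is therefore, up to a constant, the mean of s^δ against (1 + xs)^(-a) dρ, and its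
monotonicity is a Chebyshev inequality (`integral_rpow_mul_lt`). The lower bounds are Jensen's
inequality for u^(-σ), as bc/(de) is the mean of s. For the upper bounds the parameters are lowered
by 1, so that the weight s appears, and Jensen is applied to the concave function (u - 1)u^(-σ).
Absence of atoms makes all inequalities strict. -/

section

open MeasureTheory Set

/-! ### Beta integrals, the binomial series and Gauss' summation. -/

theorem lintegral_rpow_mul_one_sub_rpow {p q : ℝ} (hp : 0 < p) (hq : 0 < q) :
    ∫⁻ s in Ioo (0 : ℝ) 1, ENNReal.ofReal (s ^ (p - 1) * (1 - s) ^ (q - 1)) =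
      ENNReal.ofReal (Real.Gamma p * Real.Gamma q / Real.Gamma (p + q)) := by
  have h := ProbabilityTheory.lintegral_betaPDF_eq_one hp hq
  have hB := ProbabilityTheory.beta_pos hp hq
  rw [ProbabilityTheory.lintegral_betaPDF] at h
  simp_rw [mul_assoc, ENNReal.ofReal_mul (one_div_pos.2 hB).le] at h
  rw [lintegral_const_mul' _ _ ENNReal.ofReal_ne_top] at h
  change _ = ENNReal.ofReal (ProbabilityTheory.beta p q)
  calc _ = ENNReal.ofReal (ProbabilityTheory.beta p q * (1 / ProbabilityTheory.beta p q)) *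
        ∫⁻ s in Ioo (0 : ℝ) 1, ENNReal.ofReal (s ^ (p - 1) * (1 - s) ^ (q - 1)) := by
          rw [mul_one_div_cancel hB.ne', ENNReal.ofReal_one, one_mul]
    _ = _ := by rw [ENNReal.ofReal_mul hB.le, mul_assoc, h, mul_one]

theorem ascPochhammer_eval_mul_Gamma {x : ℝ} (hx : 0 < x) (n : ℕ) :
    (ascPochhammer ℝ n).eval x * Real.Gamma x = Real.Gamma (x + n) := by
  induction n with
  | zero => simp
  | succ n ih =>
    rw [ascPochhammer_succ_eval, mul_right_comm, ih, Nat.cast_succ, ← add_assoc,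
      Real.Gamma_add_one (by positivity), mul_comm]

theorem Ring.choose_add_sub_one_eq {K : Type*} [Field K] [CharZero K] (a : K) (n : ℕ) :
    Ring.choose (a + n - 1) n = (ascPochhammer K n).eval a / (n.factorial : K) := by
  rw [← Ring.multichoose_eq, eq_div_iff (Nat.cast_ne_zero.2 n.factorial_ne_zero), mul_comm, ← nsmul_eq_mul,
    Ring.factorial_nsmul_multichoose_eq_ascPochhammer, Polynomial.ascPochhammer_smeval_eq_eval]

theorem hasSum_one_sub_cpow (a : ℝ) {z : ℂ} (hz : ‖z‖ < 1) :
    HasSum (fun n : ℕ => (((ascPochhammer ℝ n).eval a / (n.factorial : ℝ) : ℝ) : ℂ) * z ^ n)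
      ((1 - z) ^ (-a : ℂ)) := by
  have h := (Complex.one_div_one_sub_cpow_hasFPowerSeriesOnBall_zero a).hasSum
    (y := z) (by simpa [enorm_eq_nnnorm] using! hz)
  simp only [zero_add, FormalMultilinearSeries.ofScalars_apply_eq, smul_eq_mul] at h
  rw [Complex.cpow_neg, ← one_div]
  refine h.congr_fun fun n => ?_
  rw [← Ring.choose_add_sub_one_eq, Complex.ofReal_choose]
  simp

theorem hasSum_one_sub_rpow (a : ℝ) {u : ℝ} (h0 : 0 ≤ u) (h1 : u < 1) :
    HasSum (fun n : ℕ => (ascPochhammer ℝ n).eval a / (n.factorial : ℝ) * u ^ n)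
      ((1 - u) ^ (-a)) := by
  have h := hasSum_one_sub_cpow a (z := (u : ℂ)) (by simpa [abs_of_nonneg h0] using h1)
  rw [← Complex.hasSum_ofReal]
  convert h using 1
  · simp
  · rw [Complex.ofReal_cpow (by linarith)]; simp

theorem summable_ascPochhammer_mul_pow (a : ℝ) {r : ℝ} (h0 : 0 ≤ r) (h1 : r < 1) :
    Summable (fun n : ℕ => |(ascPochhammer ℝ n).eval a / (n.factorial : ℝ)| * r ^ n) := by
  have h := (hasSum_one_sub_rpow a h0 h1).summable.abs
  simpa [abs_mul, abs_of_nonneg h0] using h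

theorem tsum_Gamma_mul_pow {α u : ℝ} (hα : 0 < α) (h0 : 0 ≤ u) (h1 : u < 1) :
    ∑' k : ℕ, ENNReal.ofReal (Real.Gamma (α + k) / (k.factorial : ℝ) * u ^ k) =
      ENNReal.ofReal (Real.Gamma α * (1 - u) ^ (-α)) := by
  have h := (hasSum_one_sub_rpow α h0 h1).mul_left (Real.Gamma α)
  have hk : ∀ k : ℕ, Real.Gamma α * ((ascPochhammer ℝ k).eval α / (k.factorial : ℝ) * u ^ k) =
      Real.Gamma (α + k) / (k.factorial : ℝ) * u ^ k := fun k => by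
    rw [← ascPochhammer_eval_mul_Gamma hα]; ring
  simp_rw [hk] at h
  rw [← h.tsum_eq, ENNReal.ofReal_tsum_of_nonneg _ h.summable]
  intro k
  have := Real.Gamma_pos_of_pos (show 0 < α + k by positivity)
  positivity

/-- Gauss' summation of `₂F₁(α, β; γ; 1)` for positive parameters. -/
theorem tsum_Gamma_mul_Gamma {α β γ : ℝ} (hα : 0 < α) (hβ : 0 < β) (hγ : α + β < γ) :
    ∑' k : ℕ, ENNReal.ofReal (Real.Gamma (α + k) * Real.Gamma (β + k) /
        ((k.factorial : ℝ) * Real.Gamma (γ + k))) =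
      ENNReal.ofReal (Real.Gamma α * Real.Gamma β * Real.Gamma (γ - α - β) /
        (Real.Gamma (γ - β) * Real.Gamma (γ - α))) := by
  have hγβ : 0 < γ - β := by linarith
  have G1 := Real.Gamma_pos_of_pos hγβ
  have G2 := Real.Gamma_pos_of_pos hα
  -- Euler's integral: Γ(β+k)/Γ(γ+k) is a Beta integral divided by Γ(γ-β). Summing over k under the
  -- integral gives the binomial series (1 - u)^(-α), and a second Beta integral remains.
  have hterm : ∀ k : ℕ, ENNReal.ofReal (Real.Gamma (α + k) * Real.Gamma (β + k) /
      ((k.factorial : ℝ) * Real.Gamma (γ + k))) =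
      ∫⁻ u in Ioo (0 : ℝ) 1, ENNReal.ofReal ((Real.Gamma (γ - β))⁻¹ *
        (u ^ (β - 1) * (1 - u) ^ (γ - β - 1))) *
        ENNReal.ofReal (Real.Gamma (α + k) / (k.factorial : ℝ) * u ^ k) := by
    intro k
    have Gk := Real.Gamma_pos_of_pos (show 0 < α + k by positivity)
    have hβk : 0 < β + k := by positivity
    have hc : 0 ≤ (Real.Gamma (γ - β))⁻¹ * (Real.Gamma (α + k) / (k.factorial : ℝ)) := by
      positivity
    have e : ∀ u ∈ Ioo (0 : ℝ) 1, ENNReal.ofReal ((Real.Gamma (γ - β))⁻¹ *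
        (u ^ (β - 1) * (1 - u) ^ (γ - β - 1))) *
        ENNReal.ofReal (Real.Gamma (α + k) / (k.factorial : ℝ) * u ^ k) =
        ENNReal.ofReal ((Real.Gamma (γ - β))⁻¹ * (Real.Gamma (α + k) / (k.factorial : ℝ))) *
        ENNReal.ofReal (u ^ (β + k - 1) * (1 - u) ^ (γ - β - 1)) := by
      intro u hu
      have h1 : 0 < 1 - u := by linarith [hu.2]
      have h0 := hu.1
      rw [← ENNReal.ofReal_mul (by positivity), ← ENNReal.ofReal_mul hc,
        show β + (k : ℝ) - 1 = (β - 1) + k by ring, Real.rpow_add h0, Real.rpow_natCast]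
      ring_nf
    rw [setLIntegral_congr_fun measurableSet_Ioo e,
      lintegral_const_mul' _ _ ENNReal.ofReal_ne_top,
      lintegral_rpow_mul_one_sub_rpow hβk hγβ, ← ENNReal.ofReal_mul hc,
      show β + (k : ℝ) + (γ - β) = γ + k by ring]
    congr 1
    field_simp
  simp_rw [hterm]
  rw [← lintegral_tsum (fun k => by fun_prop)]
  have e : ∀ u ∈ Ioo (0 : ℝ) 1, (∑' k : ℕ, ENNReal.ofReal ((Real.Gamma (γ - β))⁻¹ *
        (u ^ (β - 1) * (1 - u) ^ (γ - β - 1))) *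
        ENNReal.ofReal (Real.Gamma (α + k) / (k.factorial : ℝ) * u ^ k)) =
      ENNReal.ofReal ((Real.Gamma (γ - β))⁻¹ * Real.Gamma α) *
        ENNReal.ofReal (u ^ (β - 1) * (1 - u) ^ (γ - α - β - 1)) := by
    intro u hu
    have h1 : 0 < 1 - u := by linarith [hu.2]
    have h0 := hu.1
    rw [ENNReal.tsum_mul_left, tsum_Gamma_mul_pow hα h0.le hu.2,
      ← ENNReal.ofReal_mul (by positivity), ← ENNReal.ofReal_mul (by positivity),
      show γ - α - β - 1 = (γ - β - 1) + -α by ring, Real.rpow_add h1]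
    ring_nf
  rw [setLIntegral_congr_fun measurableSet_Ioo e,
    lintegral_const_mul' _ _ ENNReal.ofReal_ne_top,
    lintegral_rpow_mul_one_sub_rpow hβ (by linarith), ← ENNReal.ofReal_mul (by positivity),
    show β + (γ - α - β) = γ - α by ring]
  congr 1
  field_simp

/-! ### The representing measure. -/

/-- `ρ` lives on `(0, 1)`, has no atoms, and its Mellin transform is the quotient of Gamma
functions whose values at the integers are the moments belonging to `₃F₂(·, b, c; d, e; ·)`. -/
structure IsMomentMeasure (b c d e : ℝ) (ρ : Measure ℝ) : Prop where
  isFiniteMeasure : IsFiniteMeasure ρ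
  nullSingletons : ∀ s : ℝ, ρ {s} = 0
  ae_mem : ∀ᵐ s ∂ρ, s ∈ Ioo (0 : ℝ) 1
  integral_rpow : ∀ t : ℝ, 0 ≤ t → ∫ s, s ^ t ∂ρ =
    Real.Gamma (b + t) * Real.Gamma (c + t) / (Real.Gamma (d + t) * Real.Gamma (e + t))

/-- The density is s^(c-1) (1-s)^(ψ-1) ₂F₁(d-b, e-b; ψ; 1-s) / Γ(ψ) with ψ = d+e-b-c, written as a
series in 1-s. Its coefficients are positive since b < d and b < e. Beta integrals term by term turn
each moment into a Gauss sum. Nonnegative extended-real integrals make the interchange of sum and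
integral free of convergence checks. -/
theorem exists_isMomentMeasure_of_lt {b c d e : ℝ} (hb : 0 < b) (hc : 0 < c) (hbd : b < d)
    (hbe : b < e) (hs : 0 < d + e - b - c) : ∃ ρ, IsMomentMeasure b c d e ρ := by
  set ψ := d + e - b - c with hψ
  have hα : 0 < d - b := by linarith
  have hβ : 0 < e - b := by linarith
  have GK : 0 < Real.Gamma (d - b) * Real.Gamma (e - b) :=
    mul_pos (Real.Gamma_pos_of_pos hα) (Real.Gamma_pos_of_pos hβ)
  set A : ℕ → ℝ := fun k => (Real.Gamma (d - b) * Real.Gamma (e - b))⁻¹ *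
    (Real.Gamma (d - b + k) * Real.Gamma (e - b + k) /
    ((k.factorial : ℝ) * Real.Gamma (ψ + k))) with hA
  have hApos : ∀ k, 0 ≤ A k := fun k => by
    have h1 := Real.Gamma_pos_of_pos (show 0 < d - b + k by positivity)
    have h2 := Real.Gamma_pos_of_pos (show 0 < e - b + k by positivity)
    have h3 := Real.Gamma_pos_of_pos (show 0 < ψ + k by positivity)
    positivity
  set w : ℝ → ENNReal := fun s => ∑' k : ℕ,
    ENNReal.ofReal (A k * (s ^ (c - 1) * (1 - s) ^ (ψ + k - 1))) with hw
  have hwm : Measurable w := by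
    refine Measurable.tsum fun k => ?_
    fun_prop
  set ρ := (volume.restrict (Ioo (0 : ℝ) 1)).withDensity w with hρ
  have hac : ρ ≪ volume.restrict (Ioo (0 : ℝ) 1) := withDensity_absolutelyContinuous _ _
  have hmem : ∀ᵐ s ∂ρ, s ∈ Ioo (0 : ℝ) 1 := hac.ae_le (ae_restrict_mem measurableSet_Ioo)
  have key : ∀ t : ℝ, 0 ≤ t → ∫⁻ s, ENNReal.ofReal (s ^ t) ∂ρ = ENNReal.ofReal
      (Real.Gamma (b + t) * Real.Gamma (c + t) / (Real.Gamma (d + t) * Real.Gamma (e + t))) := by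
    intro t ht
    have hct : 0 < c + t := by positivity
    have Gct := Real.Gamma_pos_of_pos hct
    rw [hρ, lintegral_withDensity_eq_lintegral_mul _ hwm (by fun_prop)]
    have e1 : ∀ s ∈ Ioo (0 : ℝ) 1, (w * fun s => ENNReal.ofReal (s ^ t)) s =
        ∑' k : ℕ, ENNReal.ofReal (A k) *
          ENNReal.ofReal (s ^ (c + t - 1) * (1 - s) ^ (ψ + k - 1)) := by
      intro s hs
      have h1 : 0 < 1 - s := by linarith [hs.2]
      have h0 := hs.1
      rw [Pi.mul_apply, hw, ← ENNReal.tsum_mul_right]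
      refine tsum_congr fun k => ?_
      have := hApos k
      rw [← ENNReal.ofReal_mul (by positivity), ← ENNReal.ofReal_mul this,
        show c + t - 1 = (c - 1) + t by ring, Real.rpow_add h0]
      ring_nf
    rw [setLIntegral_congr_fun measurableSet_Ioo e1, lintegral_tsum (fun k => by fun_prop)]
    have e2 : ∀ k : ℕ, ∫⁻ s in Ioo (0 : ℝ) 1, ENNReal.ofReal (A k) *
          ENNReal.ofReal (s ^ (c + t - 1) * (1 - s) ^ (ψ + k - 1)) =
        ENNReal.ofReal ((Real.Gamma (d - b) * Real.Gamma (e - b))⁻¹ * Real.Gamma (c + t)) *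
        ENNReal.ofReal (Real.Gamma (d - b + k) * Real.Gamma (e - b + k) /
          ((k.factorial : ℝ) * Real.Gamma (d + e - b + t + k))) := by
      intro k
      have h3 := Real.Gamma_pos_of_pos (show 0 < ψ + k by positivity)
      rw [lintegral_const_mul' _ _ ENNReal.ofReal_ne_top,
        lintegral_rpow_mul_one_sub_rpow hct (by positivity), ← ENNReal.ofReal_mul (hApos k),
        ← ENNReal.ofReal_mul (by positivity),
        show c + t + (ψ + k) = d + e - b + t + k by rw [hψ]; ring]
      congr 1
      simp only [hA]
      field_simp
    simp_rw [e2]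
    -- Gauss' formula with γ = d+e-b+t; its convergence condition reduces to b + t > 0.
    rw [ENNReal.tsum_mul_left, tsum_Gamma_mul_Gamma hα hβ (by linarith),
      ← ENNReal.ofReal_mul (by positivity),
      show d + e - b + t - (d - b) - (e - b) = b + t by ring,
      show d + e - b + t - (e - b) = d + t by ring,
      show d + e - b + t - (d - b) = e + t by ring]
    congr 1
    have := Real.Gamma_pos_of_pos hα
    have := Real.Gamma_pos_of_pos hβ
    field_simp
  refine ⟨ρ, ⟨?_⟩, fun s => ?_, hmem, fun t ht => ?_⟩
  · have h := key 0 le_rfl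
    simp only [Real.rpow_zero, ENNReal.ofReal_one, lintegral_one] at h
    rw [h]
    exact ENNReal.ofReal_lt_top
  · exact hac (by simp)
  · rw [integral_eq_lintegral_of_nonneg_ae
      (hmem.mono fun s hs => Real.rpow_nonneg hs.1.le t)
      (by fun_prop), key t ht, ENNReal.toReal_ofReal]
    have h1 := Real.Gamma_pos_of_pos (show 0 < b + t by linarith)
    have h2 := Real.Gamma_pos_of_pos (show 0 < c + t by linarith)
    have h3 := Real.Gamma_pos_of_pos (show 0 < d + t by linarith)
    have h4 := Real.Gamma_pos_of_pos (show 0 < e + t by linarith)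
    positivity

theorem exists_isMomentMeasure {b c d e : ℝ} (hb : 0 < b) (hc : 0 < c)
    (hmin : min b c < min d e) (hs : 0 < d + e - b - c) : ∃ ρ, IsMomentMeasure b c d e ρ := by
  rcases le_total b c with h | h
  · rw [min_eq_left h, lt_min_iff] at hmin
    exact exists_isMomentMeasure_of_lt hb hc hmin.1 hmin.2 hs
  · rw [min_eq_right h, lt_min_iff] at hmin
    obtain ⟨ρ, h1, h2, h3, h4⟩ := exists_isMomentMeasure_of_lt hc hb hmin.1 hmin.2 (by linarith)
    exact ⟨ρ, h1, h2, h3, fun t ht => by rw [h4 t ht, mul_comm (Real.Gamma (c + t))]⟩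

/-! ### Stieltjes transforms and the analytic continuation. -/

/-- 1 - zs = (1-s)·1 + s(1-z), and the slit plane is star-shaped about 1. -/
theorem one_sub_mul_mem_slitPlane {z : ℂ} (hz : z ∈ cutPlane) {s : ℝ} (hs : s ∈ Icc (0 : ℝ) 1) :
    1 - z * s ∈ Complex.slitPlane := by
  have h := Complex.starConvex_one_slitPlane hz (a := 1 - s) (b := s) (by linarith [hs.2]) hs.1
    (by ring)
  convert h using 1
  simp only [Complex.real_smul]
  push_cast
  ring

theorem integrable_of_continuousOn_Icc {E : Type*} [NormedAddCommGroup E] {ρ : Measure ℝ}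
    [IsFiniteMeasure ρ] (hρ : ∀ᵐ s ∂ρ, s ∈ Ioo (0 : ℝ) 1) {f : ℝ → E}
    (hf : ContinuousOn f (Icc 0 1)) : Integrable f ρ := by
  have h : IntegrableOn f (Icc 0 1) ρ := hf.integrableOn_compact isCompact_Icc
  rwa [IntegrableOn, Measure.restrict_eq_self_of_ae_mem
    (hρ.mono fun s hs => Ioo_subset_Icc_self hs)] at h

/-- The generalized Stieltjes transform `∫ s ^ δ (1 - z s) ^ (-a) dρ(s)`. -/
noncomputable def stieltjes (ρ : Measure ℝ) (a δ : ℝ) (z : ℂ) : ℂ :=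
  ∫ s, ((s ^ δ : ℝ) : ℂ) * (1 - z * s) ^ (-a : ℂ) ∂ρ

theorem continuousOn_rpow_mul_one_sub_cpow {z : ℂ} (hz : z ∈ cutPlane) {δ : ℝ} (hδ : 0 ≤ δ)
    (a : ℂ) : ContinuousOn (fun s : ℝ => ((s ^ δ : ℝ) : ℂ) * (1 - z * s) ^ a) (Icc 0 1) := by
  refine ContinuousOn.mul ?_ (ContinuousOn.cpow_const (by fun_prop)
    fun s hs => one_sub_mul_mem_slitPlane hz hs)
  exact (Complex.continuous_ofReal.comp (Real.continuous_rpow_const hδ)).continuousOn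

/-- The z-derivative of the integrand is jointly continuous on a compact disc times [0, 1], hence
bounded by a constant, which the finite measure integrates. -/
theorem differentiableOn_stieltjes {ρ : Measure ℝ} [IsFiniteMeasure ρ]
    (hρ : ∀ᵐ s ∂ρ, s ∈ Ioo (0 : ℝ) 1) (a : ℝ) {δ : ℝ} (hδ : 0 ≤ δ) :
    DifferentiableOn ℂ (stieltjes ρ a δ) cutPlane := by
  intro z₀ hz₀
  obtain ⟨r, hr, hrK⟩ := Metric.nhds_basis_closedBall.mem_iff.1 (isOpen_cutPlane.mem_nhds hz₀)
  have hcont : ContinuousOn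
      (fun p : ℂ × ℝ => ((p.2 ^ δ : ℝ) : ℂ) * (p.2 * a * (1 - p.1 * p.2) ^ (-a - 1 : ℂ)))
      (Metric.closedBall z₀ r ×ˢ Icc 0 1) := by
    refine ContinuousOn.mul ?_ (ContinuousOn.mul (by fun_prop)
      (ContinuousOn.cpow_const (by fun_prop)
        fun p hp => one_sub_mul_mem_slitPlane (hrK hp.1) hp.2))
    exact (Complex.continuous_ofReal.comp ((Real.continuous_rpow_const hδ).comp
      continuous_snd)).continuousOn
  obtain ⟨C, hC⟩ := ((isCompact_closedBall z₀ r).prod isCompact_Icc).exists_bound_of_continuousOn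
    hcont
  have := hasDerivAt_integral_of_dominated_loc_of_deriv_le (μ := ρ) (x₀ := z₀)
    (F := fun (z : ℂ) (s : ℝ) => ((s ^ δ : ℝ) : ℂ) * (1 - z * s) ^ (-a : ℂ))
    (F' := fun (z : ℂ) (s : ℝ) => ((s ^ δ : ℝ) : ℂ) * (s * a * (1 - z * s) ^ (-a - 1 : ℂ)))
    (bound := fun _ => C) (Metric.closedBall_mem_nhds z₀ hr) ?_ ?_ ?_ ?_ (integrable_const C) ?_
  · exact this.2.differentiableAt.differentiableWithinAt
  · exact Filter.Eventually.of_forall fun z => by fun_prop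
  · exact integrable_of_continuousOn_Icc hρ (continuousOn_rpow_mul_one_sub_cpow hz₀ hδ _)
  · fun_prop
  · filter_upwards [hρ] with s hs z hz
    exact hC (z, s) ⟨hz, Ioo_subset_Icc_self hs⟩
  · filter_upwards [hρ] with s hs z hz
    refine HasDerivAt.const_mul _ ?_
    have h1 : HasDerivAt (fun z : ℂ => 1 - z * s) (-(1 * (s : ℂ))) z :=
      ((hasDerivAt_id z).mul_const (s : ℂ)).const_sub 1
    refine (h1.cpow_const (c := (-a : ℂ))
      (one_sub_mul_mem_slitPlane (hrK hz) (Ioo_subset_Icc_self hs))).congr_deriv ?_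
    ring

theorem hasSum_stieltjes {ρ : Measure ℝ} [IsFiniteMeasure ρ]
    (hρ : ∀ᵐ s ∂ρ, s ∈ Ioo (0 : ℝ) 1) (a : ℝ) {δ : ℝ} (hδ : 0 ≤ δ) {z : ℂ} (hz : ‖z‖ < 1) :
    HasSum (fun n : ℕ => (((ascPochhammer ℝ n).eval a / (n.factorial : ℝ) *
      ∫ s, s ^ (δ + n) ∂ρ : ℝ) : ℂ) * z ^ n) (stieltjes ρ a δ z) := by
  set A : ℕ → ℝ := fun n => (ascPochhammer ℝ n).eval a / (n.factorial : ℝ) with hA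
  set f : ℕ → ℝ → ℂ := fun n s => ((s ^ (δ + n) : ℝ) : ℂ) * (A n * z ^ n) with hf
  have hint : ∀ n, Integrable (f n) ρ := fun n => integrable_of_continuousOn_Icc hρ
    ((Complex.continuous_ofReal.comp (Real.continuous_rpow_const
      (by positivity : 0 ≤ δ + (n : ℝ)))).mul continuous_const).continuousOn
  have hbound : ∀ n, ∀ᵐ s ∂ρ, ‖f n s‖ ≤ |A n| * ‖z‖ ^ n := fun n => by
    filter_upwards [hρ] with s hs
    simp only [hf, norm_mul, norm_pow, Complex.norm_real, Real.norm_eq_abs]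
    -- On (0, 1) the power of s is harmless, so the absolutely convergent binomial series at ‖z‖
    -- justifies integrating term by term.
    have h1 : |s ^ (δ + n)| ≤ 1 := by
      rw [abs_of_nonneg (Real.rpow_nonneg hs.1.le _)]
      exact Real.rpow_le_one hs.1.le hs.2.le (by positivity)
    exact mul_le_of_le_one_left (by positivity) h1
  have hsum : Summable fun n => ∫ s, ‖f n s‖ ∂ρ := by
    refine Summable.of_nonneg_of_le (fun n => integral_nonneg fun s => norm_nonneg _)
      (fun n => ?_) ((summable_ascPochhammer_mul_pow a (norm_nonneg z) hz).mul_left (ρ.real univ))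
    calc ∫ s, ‖f n s‖ ∂ρ ≤ ∫ _, |A n| * ‖z‖ ^ n ∂ρ :=
          integral_mono_ae (hint n).norm (integrable_const _) (hbound n)
      _ = _ := by rw [integral_const, smul_eq_mul]
  have h := hasSum_integral_of_summable_integral_norm hint hsum
  have e1 : ∫ s, ∑' n, f n s ∂ρ = stieltjes ρ a δ z := by
    refine integral_congr_ae ?_
    filter_upwards [hρ] with s hs
    have hzs : ‖z * s‖ < 1 := by
      rw [norm_mul, Complex.norm_real, Real.norm_eq_abs, abs_of_pos hs.1]
      exact lt_of_le_of_lt (mul_le_of_le_one_right (norm_nonneg _) hs.2.le) hz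
    rw [← ((hasSum_one_sub_cpow a hzs).mul_left ((s ^ δ : ℝ) : ℂ)).tsum_eq]
    refine tsum_congr fun n => ?_
    simp only [hf, hA]
    rw [Real.rpow_add hs.1, Real.rpow_natCast]
    push_cast
    ring
  rw [e1] at h
  refine h.congr_fun fun n => ?_
  simp only [hf, hA]
  rw [integral_mul_const, integral_complex_ofReal]
  push_cast
  ring

/-- The Mellin transform of a moment measure. -/
noncomputable def momentFactor (b c d e t : ℝ) : ℝ :=
  Real.Gamma (b + t) * Real.Gamma (c + t) / (Real.Gamma (d + t) * Real.Gamma (e + t))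

theorem momentFactor_pos {b c d e t : ℝ} (hb : 0 < b) (hc : 0 < c) (hd : 0 < d) (he : 0 < e)
    (ht : 0 ≤ t) : 0 < momentFactor b c d e t := by
  have h1 := Real.Gamma_pos_of_pos (show 0 < b + t by linarith)
  have h2 := Real.Gamma_pos_of_pos (show 0 < c + t by linarith)
  have h3 := Real.Gamma_pos_of_pos (show 0 < d + t by linarith)
  have h4 := Real.Gamma_pos_of_pos (show 0 < e + t by linarith)
  unfold momentFactor
  positivity

/-- The moment of order δ + n is `momentFactor b c d e δ` times the quotient of Pochhammer symbols
at the shifted parameters, so one measure serves every δ ≥ 0. -/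
theorem isHyp3F2_stieltjes {b c d e : ℝ} (hb : 0 < b) (hc : 0 < c) (hd : 0 < d) (he : 0 < e)
    {ρ : Measure ℝ} (hρ : IsMomentMeasure b c d e ρ) (a : ℝ) {δ : ℝ} (hδ : 0 ≤ δ) :
    IsHyp3F2 a (b + δ) (c + δ) (d + δ) (e + δ)
      (fun z => ((momentFactor b c d e δ)⁻¹ : ℝ) * stieltjes ρ a δ z) where
  differentiableOn := by
    have := hρ.isFiniteMeasure
    exact (differentiableOn_stieltjes hρ.ae_mem a hδ).const_mul _
  hasSum := by
    intro z hz
    have := hρ.isFiniteMeasure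
    refine ((hasSum_stieltjes hρ.ae_mem a hδ hz).mul_left _).congr_fun fun n => ?_
    have hM := momentFactor_pos hb hc hd he hδ
    rw [hρ.integral_rpow _ (by positivity), ← mul_assoc, ← Complex.ofReal_mul]
    congr 2
    have h3 := Real.Gamma_pos_of_pos (show 0 < d + δ by linarith)
    have h4 := Real.Gamma_pos_of_pos (show 0 < e + δ by linarith)
    have h1 := Real.Gamma_pos_of_pos (show 0 < b + δ by linarith)
    have h2 := Real.Gamma_pos_of_pos (show 0 < c + δ by linarith)
    have p3 := ascPochhammer_pos n (d + δ) (by linarith)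
    have p4 := ascPochhammer_pos n (e + δ) (by linarith)
    simp only [← add_assoc]
    rw [← ascPochhammer_eval_mul_Gamma (show 0 < b + δ by linarith),
      ← ascPochhammer_eval_mul_Gamma (show 0 < c + δ by linarith),
      ← ascPochhammer_eval_mul_Gamma (show 0 < d + δ by linarith),
      ← ascPochhammer_eval_mul_Gamma (show 0 < e + δ by linarith), hyp3F2Coeff, momentFactor]
    field_simp

theorem realHyp3F2_neg_eq_integral {b c d e : ℝ} (hb : 0 < b) (hc : 0 < c) (hd : 0 < d)
    (he : 0 < e) {ρ : Measure ℝ} (hρ : IsMomentMeasure b c d e ρ) (a : ℝ) {δ : ℝ} (hδ : 0 ≤ δ)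
    {x : ℝ} (hx : -1 < x) :
    realHyp3F2 a (b + δ) (c + δ) (d + δ) (e + δ) (-x) =
      (momentFactor b c d e δ)⁻¹ * ∫ s, s ^ δ * (1 + x * s) ^ (-a) ∂ρ := by
  have hF := isHyp3F2_stieltjes hb hc hd he hρ a hδ
  have h := (isHyp3F2_hyp3F2 ⟨_, hF⟩).eqOn hF (ofReal_mem_cutPlane (x := -x) (by linarith))
  have e1 : stieltjes ρ a δ ((-x : ℝ) : ℂ) =
      ((∫ s, s ^ δ * (1 + x * s) ^ (-a) ∂ρ : ℝ) : ℂ) := by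
    rw [← integral_complex_ofReal]
    refine integral_congr_ae ?_
    filter_upwards [hρ.ae_mem] with s hs
    have h0 : 0 ≤ 1 + x * s := by nlinarith [hs.1, hs.2]
    rw [Complex.ofReal_mul, Complex.ofReal_cpow h0]
    push_cast
    ring_nf
  rw [realHyp3F2, h, e1, ← Complex.ofReal_mul, Complex.ofReal_re]

/-! ### Strict positivity and the Chebyshev inequality. -/

theorem integral_pos_of_ae_pos {α : Type*} {m : MeasurableSpace α} {μ : Measure α} (hμ : μ ≠ 0)
    {f : α → ℝ} (hf : Integrable f μ) (hpos : ∀ᵐ s ∂μ, 0 < f s) : 0 < ∫ s, f s ∂μ := by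
  rw [integral_pos_iff_support_of_nonneg_ae (hpos.mono fun s hs => hs.le) hf]
  have h : Function.support f =ᵐ[μ] (univ : Set α) := by
    refine Filter.eventuallyEq_univ.2 ?_
    filter_upwards [hpos] with s hs using hs.ne'
  rw [measure_congr h]
  exact Measure.measure_univ_pos.2 hμ

theorem IsMomentMeasure.ae_ne {b c d e : ℝ} {ρ : Measure ℝ} (hρ : IsMomentMeasure b c d e ρ)
    (s₀ : ℝ) : ∀ᵐ s ∂ρ, s ≠ s₀ := by
  rw [ae_iff]
  simpa using hρ.nullSingletons s₀

theorem IsMomentMeasure.ne_zero {b c d e : ℝ} (hb : 0 < b) (hc : 0 < c) (hd : 0 < d)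
    (he : 0 < e) {ρ : Measure ℝ} (hρ : IsMomentMeasure b c d e ρ) : ρ ≠ 0 := by
  rintro rfl
  have h := hρ.integral_rpow 0 le_rfl
  have h1 := momentFactor_pos hb hc hd he (le_refl 0)
  rw [momentFactor, ← h] at h1
  simp at h1

theorem one_add_mul_pos {x s : ℝ} (hx : -1 < x) (hs : s ∈ Icc (0 : ℝ) 1) : 0 < 1 + x * s := by
  rcases le_or_gt 0 x with h | h
  · nlinarith [hs.1, mul_nonneg h hs.1]
  · nlinarith [hs.1, hs.2]

theorem continuousOn_rpow_mul_one_add_rpow {x : ℝ} (hx : -1 < x) {δ : ℝ} (hδ : 0 ≤ δ) (a : ℝ) :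
    ContinuousOn (fun s : ℝ => s ^ δ * (1 + x * s) ^ a) (Icc 0 1) :=
  (Real.continuous_rpow_const hδ).continuousOn.mul
    (ContinuousOn.rpow_const (by fun_prop) fun s hs => Or.inl (one_add_mul_pos hx hs).ne')

theorem integrable_one_add_rpow {ρ : Measure ℝ} [IsFiniteMeasure ρ]
    (hρ : ∀ᵐ s ∂ρ, s ∈ Ioo (0 : ℝ) 1) {x : ℝ} (hx : -1 < x) {δ : ℝ} (hδ : 0 ≤ δ) (a : ℝ) :
    Integrable (fun s : ℝ => s ^ δ * (1 + x * s) ^ a) ρ :=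
  integrable_of_continuousOn_Icc hρ (continuousOn_rpow_mul_one_add_rpow hx hδ a)

theorem integral_one_add_rpow_pos {ρ : Measure ℝ} [IsFiniteMeasure ρ] (h0 : ρ ≠ 0)
    (hρ : ∀ᵐ s ∂ρ, s ∈ Ioo (0 : ℝ) 1) {x : ℝ} (hx : -1 < x) {δ : ℝ} (hδ : 0 ≤ δ) (a : ℝ) :
    0 < ∫ s, s ^ δ * (1 + x * s) ^ a ∂ρ := by
  refine integral_pos_of_ae_pos h0 (integrable_one_add_rpow hρ hx hδ a) ?_
  filter_upwards [hρ] with s hs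
  have := one_add_mul_pos hx (Ioo_subset_Icc_self hs)
  have := hs.1
  positivity

/-- A weighted form of Chebyshev's integral inequality: if `g / f` is strictly decreasing on
`(0, 1)`, then its mean gets smaller when the weight `s ^ δ` is inserted. -/
theorem integral_rpow_mul_lt {ρ : Measure ℝ} [IsFiniteMeasure ρ] (h0 : ρ ≠ 0)
    (hρ : ∀ᵐ s ∂ρ, s ∈ Ioo (0 : ℝ) 1) (hat : ∀ s₀ : ℝ, ∀ᵐ s ∂ρ, s ≠ s₀) {δ : ℝ} (hδ : 0 < δ)
    {f g : ℝ → ℝ} (hf : ContinuousOn f (Icc 0 1)) (hg : ContinuousOn g (Icc 0 1))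
    (hfpos : ∀ s ∈ Ioo (0 : ℝ) 1, 0 < f s)
    (hfg : ∀ s ∈ Ioo (0 : ℝ) 1, ∀ t ∈ Ioo (0 : ℝ) 1, s < t → g t * f s < g s * f t) :
    (∫ s, s ^ δ * g s ∂ρ) * (∫ s, f s ∂ρ) < (∫ s, s ^ δ * f s ∂ρ) * (∫ s, g s ∂ρ) := by
  have hδc : ContinuousOn (fun s : ℝ => s ^ δ) (Icc 0 1) :=
    (Real.continuous_rpow_const hδ.le).continuousOn
  have If := integrable_of_continuousOn_Icc hρ hf
  have Ig := integrable_of_continuousOn_Icc hρ hg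
  have Ihf : Integrable (fun s => s ^ δ * f s) ρ := integrable_of_continuousOn_Icc hρ (hδc.mul hf)
  have Ihg : Integrable (fun s => s ^ δ * g s) ρ := integrable_of_continuousOn_Icc hρ (hδc.mul hg)
  have Pf : 0 < ∫ s, f s ∂ρ := integral_pos_of_ae_pos h0 If (hρ.mono hfpos)
  have Phf : 0 < ∫ s, s ^ δ * f s ∂ρ := integral_pos_of_ae_pos h0 Ihf
    (hρ.mono fun s hs => mul_pos (Real.rpow_pos_of_pos hs.1 δ) (hfpos s hs))
  have Plt : ∫ s, s ^ δ * f s ∂ρ < ∫ s, f s ∂ρ := by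
    rw [← sub_pos, ← integral_sub If Ihf]
    refine integral_pos_of_ae_pos h0 (If.sub Ihf) (hρ.mono fun s hs => ?_)
    have h1 := Real.rpow_lt_one hs.1.le hs.2 hδ
    nlinarith [hfpos s hs]
  -- m is the f-weighted mean of s^δ, and s₀ below is the point where s^δ attains it.
  set m := (∫ s, s ^ δ * f s ∂ρ) / ∫ s, f s ∂ρ with hm
  have hm0 : 0 < m := div_pos Phf Pf
  have hm1 : m < 1 := (div_lt_one Pf).2 Plt
  set s₀ := m ^ δ⁻¹ with hs₀
  have hs₀m : s₀ ^ δ = m := Real.rpow_inv_rpow hm0.le hδ.ne'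
  have hs₀I : s₀ ∈ Ioo (0 : ℝ) 1 :=
    ⟨Real.rpow_pos_of_pos hm0 _, Real.rpow_lt_one hm0.le hm1 (inv_pos.2 hδ)⟩
  have Pf0 := hfpos s₀ hs₀I
  have J1 : Integrable (fun s => g s₀ * (s ^ δ * f s - m * f s)) ρ :=
    (Ihf.sub (If.const_mul m)).const_mul (g s₀)
  have J2 : Integrable (fun s => f s₀ * (s ^ δ * g s - m * g s)) ρ :=
    (Ihg.sub (Ig.const_mul m)).const_mul (f s₀)
  have key := integral_pos_of_ae_pos h0 (J1.sub J2) (by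
    filter_upwards [hρ, hat s₀] with s hs hne
    -- Both factors on the right change sign exactly at s₀, in the same direction. After integration
    -- the term with g(s₀) vanishes by the choice of m.
    have e : g s₀ * (s ^ δ * f s - m * f s) - f s₀ * (s ^ δ * g s - m * g s) =
      (s ^ δ - s₀ ^ δ) * (g s₀ * f s - g s * f s₀) := by rw [hs₀m]; ring
    simp only [Pi.sub_apply]
    rw [e]
    rcases lt_or_gt_of_ne hne with h | h
    · have h1 := Real.rpow_lt_rpow hs.1.le h hδ
      have h2 := hfg s hs s₀ hs₀I h
      exact mul_pos_of_neg_of_neg (by linarith) (by linarith)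
    · have h1 := Real.rpow_lt_rpow hs₀I.1.le h hδ
      have h2 := hfg s₀ hs₀I s hs h
      exact mul_pos (by linarith) (by linarith))
  have hval : ∫ s, (g s₀ * (s ^ δ * f s - m * f s) - f s₀ * (s ^ δ * g s - m * g s)) ∂ρ =
      g s₀ * ((∫ s, s ^ δ * f s ∂ρ) - m * ∫ s, f s ∂ρ) -
        f s₀ * ((∫ s, s ^ δ * g s ∂ρ) - m * ∫ s, g s ∂ρ) := by
    rw [integral_sub J1 J2, integral_const_mul, integral_const_mul,
      integral_sub Ihf (If.const_mul m), integral_sub Ihg (Ig.const_mul m), integral_const_mul,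
      integral_const_mul]
  have hmf : m * ∫ s, f s ∂ρ = ∫ s, s ^ δ * f s ∂ρ := div_mul_cancel₀ _ Pf.ne'
  have key2 : 0 < g s₀ * ((∫ s, s ^ δ * f s ∂ρ) - m * ∫ s, f s ∂ρ) -
        f s₀ * ((∫ s, s ^ δ * g s ∂ρ) - m * ∫ s, g s ∂ρ) := hval ▸ key
  rw [hmf, sub_self, mul_zero, zero_sub, ← mul_neg, neg_sub] at key2
  have key3 := (mul_pos_iff_of_pos_left Pf0).1 key2
  rw [← hmf]
  nlinarith

/-- The difference of the two sides is (y-x)(t-s): a denominator-free form of the monotonicity of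
(1+ys)/(1+xs) in s. -/
theorem one_add_mul_mul_lt {x y s t : ℝ} (hxy : x < y) (hst : s < t) :
    (1 + y * s) * (1 + x * t) < (1 + y * t) * (1 + x * s) := by
  nlinarith [mul_pos (sub_pos.2 hxy) (sub_pos.2 hst)]

/-! ### Tangent lines and Jensen's inequality. -/

theorem rpow_neg_lt_one_sub {u σ : ℝ} (hu : 0 < u) (h1 : u ≠ 1) (hσ : 0 < σ) :
    1 - σ * (u - 1) < u ^ (-σ) := by
  have h := Real.log_lt_sub_one_of_pos hu h1
  have h2 := Real.add_one_le_exp (Real.log u * -σ)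
  rw [Real.rpow_def_of_pos hu]
  nlinarith

/-- The tangent to the convex function `u ↦ u ^ (-σ)` lies below it. -/
theorem tangent_lt_rpow_neg {u U σ : ℝ} (hu : 0 < u) (hU : 0 < U) (h : u ≠ U) (hσ : 0 < σ) :
    U ^ (-σ) - σ * U ^ (-σ) / U * (u - U) < u ^ (-σ) := by
  -- By homogeneity the tangent at U reduces to the tangent at 1, applied to u/U.
  have h1 := rpow_neg_lt_one_sub (div_pos hu hU) (fun h' => h ((div_eq_one_iff_eq hU.ne').1 h')) hσ
  have hUσ : 0 < U ^ (-σ) := Real.rpow_pos_of_pos hU _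
  rw [Real.div_rpow hu.le hU.le, lt_div_iff₀ hUσ] at h1
  refine lt_of_eq_of_lt ?_ h1
  field_simp

/-- The tangent to the concave function `u ↦ (u - 1) u ^ (-σ)` lies above it. -/
theorem sub_one_mul_rpow_neg_lt_tangent {u U σ : ℝ} (hu : 0 < u) (hU : 0 < U) (h : u ≠ U)
    (hσ : 0 < σ) (hσ1 : σ ≤ 1) :
    (u - 1) * u ^ (-σ) <
      (U - 1) * U ^ (-σ) + ((1 - σ) * U ^ (-σ) + σ * U ^ (-σ) / U) * (u - U) := by
  have h1 := tangent_lt_rpow_neg hu hU h hσ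
  -- Split (u-1)u^(-σ) = u^(1-σ) - u^(-σ). Bernoulli bounds the first power, possibly with equality
  -- (σ = 1); strictness comes from the second.
  have h2 : u ^ (1 - σ) ≤ U ^ (1 - σ) + (1 - σ) * U ^ (-σ) * (u - U) := by
    have h3 := rpow_one_add_le_one_add_mul_self (s := u / U - 1) (p := 1 - σ)
      (by linarith [div_pos hu hU]) (by linarith) (by linarith)
    have hU1 : 0 < U ^ (1 - σ) := Real.rpow_pos_of_pos hU _
    rw [add_sub_cancel, Real.div_rpow hu.le hU.le, div_le_iff₀ hU1] at h3
    refine h3.trans_eq ?_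
    rw [sub_eq_add_neg 1 σ, Real.rpow_add hU, Real.rpow_one]
    field_simp
  rw [sub_eq_add_neg 1 σ, Real.rpow_add hU, Real.rpow_add hu, Real.rpow_one, Real.rpow_one] at h2
  nlinarith

/-- Jensen: integrate the tangent at 1 + xt; as t is the mean, the linear term drops out. -/
theorem mul_rpow_neg_lt_integral {ρ : Measure ℝ} [IsFiniteMeasure ρ] (h0 : ρ ≠ 0)
    (hρ : ∀ᵐ s ∂ρ, s ∈ Ioo (0 : ℝ) 1) (hat : ∀ s₀ : ℝ, ∀ᵐ s ∂ρ, s ≠ s₀) {x t σ : ℝ}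
    (hx : -1 < x) (hx0 : x ≠ 0) (hσ : 0 < σ) (ht : t ∈ Icc (0 : ℝ) 1)
    (hmean : ∫ s, s ∂ρ = ρ.real univ * t) :
    ρ.real univ * (1 + x * t) ^ (-σ) < ∫ s, (1 + x * s) ^ (-σ) ∂ρ := by
  have hU := one_add_mul_pos hx ht
  set U := 1 + x * t with hUdef
  have I1 : Integrable (fun s : ℝ => (1 + x * s) ^ (-σ)) ρ := by
    simpa using integrable_one_add_rpow hρ hx le_rfl (-σ)
  have I2 : Integrable (fun s : ℝ => s) ρ := integrable_of_continuousOn_Icc hρ continuousOn_id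
  set k := σ * U ^ (-σ) / U * x with hk
  have I3 : Integrable (fun s : ℝ => (U ^ (-σ) + k * t) - k * s) ρ :=
    (integrable_const _).sub (I2.const_mul k)
  have key := integral_pos_of_ae_pos h0 (I1.sub I3) (by
    filter_upwards [hρ, hat t] with s hs hne
    have h1 := tangent_lt_rpow_neg (one_add_mul_pos hx (Ioo_subset_Icc_self hs)) hU
      (fun h => hne (mul_left_cancel₀ hx0 (add_left_cancel h))) hσ
    have e : σ * U ^ (-σ) / U * (1 + x * s - U) = k * s - k * t := by rw [hk, hUdef]; ring
    rw [e] at h1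
    simp only [Pi.sub_apply]
    linarith)
  rw [integral_sub' I1 I3, integral_sub (integrable_const _) (I2.const_mul k),
    integral_const_mul, integral_const, hmean, smul_eq_mul] at key
  nlinarith

/-- With u = 1 + xs one has xs(1+xs)^(-σ) = (u-1)u^(-σ), concave for σ ≤ 1. Jensen applies, and x >
0 is divided out. -/
theorem integral_mul_rpow_neg_lt {ρ : Measure ℝ} [IsFiniteMeasure ρ] (h0 : ρ ≠ 0)
    (hρ : ∀ᵐ s ∂ρ, s ∈ Ioo (0 : ℝ) 1) (hat : ∀ s₀ : ℝ, ∀ᵐ s ∂ρ, s ≠ s₀) {x t σ : ℝ}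
    (hx : 0 < x) (hσ : 0 < σ) (hσ1 : σ ≤ 1) (ht : t ∈ Icc (0 : ℝ) 1)
    (hmean : ∫ s, s ∂ρ = ρ.real univ * t) :
    ∫ s, s * (1 + x * s) ^ (-σ) ∂ρ < ρ.real univ * (t * (1 + x * t) ^ (-σ)) := by
  have hx1 : -1 < x := by linarith
  have hU := one_add_mul_pos hx1 ht
  set U := 1 + x * t with hUdef
  have I1 : Integrable (fun s : ℝ => s * (1 + x * s) ^ (-σ)) ρ := by
    simpa using integrable_one_add_rpow hρ hx1 zero_le_one (-σ)
  have I2 : Integrable (fun s : ℝ => s) ρ := integrable_of_continuousOn_Icc hρ continuousOn_id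
  set k := (1 - σ) * U ^ (-σ) + σ * U ^ (-σ) / U with hk
  have I3 : Integrable (fun s : ℝ => (t * U ^ (-σ) - k * t) + k * s) ρ :=
    (integrable_const _).add (I2.const_mul k)
  have key := integral_pos_of_ae_pos h0 (I3.sub I1) (by
    filter_upwards [hρ, hat t] with s hs hne
    have h1 := sub_one_mul_rpow_neg_lt_tangent
      (one_add_mul_pos hx1 (Ioo_subset_Icc_self hs)) hU
      (fun h => hne (mul_left_cancel₀ hx.ne' (add_left_cancel h))) hσ hσ1
    rw [← hk] at h1
    have h2 : x * (s * (1 + x * s) ^ (-σ)) < x * (t * U ^ (-σ) - k * t + k * s) := by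
      refine lt_of_eq_of_lt (by ring) (h1.trans_eq ?_)
      rw [hUdef]
      ring
    simp only [Pi.sub_apply]
    linarith [lt_of_mul_lt_mul_left h2 hx.le])
  rw [integral_sub' I3 I1, integral_add (integrable_const _) (I2.const_mul k),
    integral_const_mul, integral_const, hmean, smul_eq_mul] at key
  nlinarith

/-! ### The mean of the measure and the bounds for ₃F₂. -/

theorem momentFactor_one {b c d e : ℝ} (hb : 0 < b) (hc : 0 < c) (hd : 0 < d) (he : 0 < e) :
    momentFactor b c d e 1 = momentFactor b c d e 0 * (b * c / (d * e)) := by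
  simp only [momentFactor, add_zero, Real.Gamma_add_one hb.ne', Real.Gamma_add_one hc.ne',
    Real.Gamma_add_one hd.ne', Real.Gamma_add_one he.ne']
  have := Real.Gamma_pos_of_pos hd
  have := Real.Gamma_pos_of_pos he
  field_simp

theorem IsMomentMeasure.real_univ {b c d e : ℝ} {ρ : Measure ℝ}
    (hρ : IsMomentMeasure b c d e ρ) : ρ.real univ = momentFactor b c d e 0 := by
  have h := hρ.integral_rpow 0 le_rfl
  simpa [momentFactor] using h

theorem IsMomentMeasure.integral_id {b c d e : ℝ} (hb : 0 < b) (hc : 0 < c) (hd : 0 < d)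
    (he : 0 < e) {ρ : Measure ℝ} (hρ : IsMomentMeasure b c d e ρ) :
    ∫ s, s ∂ρ = ρ.real univ * (b * c / (d * e)) := by
  have h := hρ.integral_rpow 1 zero_le_one
  simp only [Real.rpow_one] at h
  rw [hρ.real_univ, ← momentFactor_one hb hc hd he, h, momentFactor]

/-- Keeps 1 + xt positive at the tangency point t = bc/(de) for all x > -1. If b ≤ c, then
(d-b)(e-b) > 0 gives de > b(d+e-b) > bc; the other case is symmetric. -/
theorem mul_div_mul_mem_Icc {b c d e : ℝ} (hb : 0 < b) (hc : 0 < c)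
    (hmin : min b c < min d e) (hs : 0 < d + e - b - c) :
    b * c / (d * e) ∈ Icc (0 : ℝ) 1 := by
  obtain ⟨hd, he⟩ := lt_min_iff.1 ((lt_min hb hc).trans hmin)
  refine ⟨by positivity, (div_le_one (mul_pos hd he)).2 ?_⟩
  rcases le_total b c with h | h
  · rw [min_eq_left h, lt_min_iff] at hmin
    nlinarith [mul_pos (sub_pos.2 hmin.1) (sub_pos.2 hmin.2)]
  · rw [min_eq_right h, lt_min_iff] at hmin
    nlinarith [mul_pos (sub_pos.2 hmin.1) (sub_pos.2 hmin.2)]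

theorem one_div_one_add_rpow_lt_realHyp3F2 {b c d e : ℝ} (hs : 0 < d + e - b - c) (hb : 0 < b)
    (hc : 0 < c) (hmin : min b c < min d e) {σ x : ℝ} (hσ : 0 < σ) (hx : -1 < x) (hx0 : x ≠ 0) :
    1 / (1 + x * (b * c / (d * e))) ^ σ < realHyp3F2 σ b c d e (-x) := by
  obtain ⟨hd, he⟩ := lt_min_iff.1 ((lt_min hb hc).trans hmin)
  obtain ⟨ρ, hρ⟩ := exists_isMomentMeasure hb hc hmin hs
  have := hρ.isFiniteMeasure
  have ht := mul_div_mul_mem_Icc hb hc hmin hs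
  have h := mul_rpow_neg_lt_integral (hρ.ne_zero hb hc hd he) hρ.ae_mem hρ.ae_ne hx hx0 hσ ht
    (hρ.integral_id hb hc hd he)
  have e1 := realHyp3F2_neg_eq_integral hb hc hd he hρ σ le_rfl hx
  simp only [add_zero, Real.rpow_zero, one_mul] at e1
  rw [e1, one_div, ← Real.rpow_neg (one_add_mul_pos hx ht).le, ← div_eq_inv_mul,
    lt_div_iff₀' (momentFactor_pos hb hc hd he le_rfl), ← hρ.real_univ]
  exact h

/-- Take the measure of (b-1, c-1, d-1, e-1) and shift back by δ = 1. The conditions on the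
parameters survive lowering, positivity because b, c > 1. The normalising factor at 1 contains the
mean t, which cancels the t in the Jensen bound. -/
theorem realHyp3F2_lt_one_div_one_add_rpow {b c d e : ℝ} (hs : 0 < d + e - b - c) (hb : 1 < b)
    (hc : 1 < c) (hmin : min b c < min d e) {σ x : ℝ} (hσ : 0 < σ) (hσ1 : σ ≤ 1) (hx : 0 < x) :
    realHyp3F2 σ b c d e (-x) <
      1 / (1 + x * ((b - 1) * (c - 1) / ((d - 1) * (e - 1)))) ^ σ := by
  obtain ⟨hd, he⟩ := lt_min_iff.1 ((lt_min hb hc).trans hmin)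
  have hb' := sub_pos.2 hb
  have hc' := sub_pos.2 hc
  have hd' := sub_pos.2 hd
  have he' := sub_pos.2 he
  have hs' : 0 < (d - 1) + (e - 1) - (b - 1) - (c - 1) := by linarith
  have hmin' : min (b - 1) (c - 1) < min (d - 1) (e - 1) := by
    rw [min_sub_sub_right, min_sub_sub_right]
    linarith
  have hx1 : -1 < x := by linarith
  obtain ⟨ρ, hρ⟩ := exists_isMomentMeasure hb' hc' hmin' hs'
  have := hρ.isFiniteMeasure
  have ht := mul_div_mul_mem_Icc hb' hc' hmin' hs'
  have h := integral_mul_rpow_neg_lt (hρ.ne_zero hb' hc' hd' he') hρ.ae_mem hρ.ae_ne hx hσ hσ1 ht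
    (hρ.integral_id hb' hc' hd' he')
  have e1 := realHyp3F2_neg_eq_integral hb' hc' hd' he' hρ σ zero_le_one hx1
  simp only [sub_add_cancel, Real.rpow_one] at e1
  rw [e1, one_div, ← Real.rpow_neg (one_add_mul_pos hx1 ht).le, ← div_eq_inv_mul,
    div_lt_iff₀' (momentFactor_pos hb' hc' hd' he' zero_le_one),
    momentFactor_one hb' hc' hd' he', ← hρ.real_univ, mul_assoc]
  exact h

/-! ### Monotonicity of the ratio. -/

theorem continuousOn_one_add_rpow {x : ℝ} (hx : -1 < x) (a : ℝ) :
    ContinuousOn (fun s : ℝ => (1 + x * s) ^ a) (Icc 0 1) := by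
  simpa using continuousOn_rpow_mul_one_add_rpow hx le_rfl a

/-- Chebyshev with f = (1+xs)^(-a) and g = (1+ys)^(-a): for a > 0 the quotient g/f =
((1+xs)/(1+ys))^a decreases in s. -/
theorem integral_rpow_mul_one_add_rpow_lt_of_pos {ρ : Measure ℝ} [IsFiniteMeasure ρ] (h0 : ρ ≠ 0)
    (hρ : ∀ᵐ s ∂ρ, s ∈ Ioo (0 : ℝ) 1) (hat : ∀ s₀ : ℝ, ∀ᵐ s ∂ρ, s ≠ s₀) {δ a x y : ℝ}
    (hδ : 0 < δ) (ha : 0 < a) (hx : -1 < x) (hxy : x < y) :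
    (∫ s, s ^ δ * (1 + y * s) ^ (-a) ∂ρ) * (∫ s, (1 + x * s) ^ (-a) ∂ρ) <
      (∫ s, s ^ δ * (1 + x * s) ^ (-a) ∂ρ) * (∫ s, (1 + y * s) ^ (-a) ∂ρ) := by
  have hy := hx.trans hxy
  refine integral_rpow_mul_lt h0 hρ hat hδ (continuousOn_one_add_rpow hx _)
    (continuousOn_one_add_rpow hy _)
    (fun s hs => Real.rpow_pos_of_pos (one_add_mul_pos hx (Ioo_subset_Icc_self hs)) _)
    fun s hs t ht hst => ?_
  have hs' := Ioo_subset_Icc_self hs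
  have ht' := Ioo_subset_Icc_self ht
  have p1 := one_add_mul_pos hx hs'
  have p2 := one_add_mul_pos hx ht'
  have p3 := one_add_mul_pos hy hs'
  have p4 := one_add_mul_pos hy ht'
  rw [← Real.mul_rpow p4.le p1.le, ← Real.mul_rpow p3.le p2.le]
  exact Real.rpow_lt_rpow_of_neg (mul_pos p3 p2) (one_add_mul_mul_lt hxy hst) (neg_lt_zero.2 ha)

/-- For a < 0 that quotient increases, so f and g exchange roles. -/
theorem integral_rpow_mul_one_add_rpow_lt_of_neg {ρ : Measure ℝ} [IsFiniteMeasure ρ] (h0 : ρ ≠ 0)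
    (hρ : ∀ᵐ s ∂ρ, s ∈ Ioo (0 : ℝ) 1) (hat : ∀ s₀ : ℝ, ∀ᵐ s ∂ρ, s ≠ s₀) {δ a x y : ℝ}
    (hδ : 0 < δ) (ha : a < 0) (hx : -1 < x) (hxy : x < y) :
    (∫ s, s ^ δ * (1 + x * s) ^ (-a) ∂ρ) * (∫ s, (1 + y * s) ^ (-a) ∂ρ) <
      (∫ s, s ^ δ * (1 + y * s) ^ (-a) ∂ρ) * (∫ s, (1 + x * s) ^ (-a) ∂ρ) := by
  have hy := hx.trans hxy
  refine integral_rpow_mul_lt h0 hρ hat hδ (continuousOn_one_add_rpow hy _)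
    (continuousOn_one_add_rpow hx _)
    (fun s hs => Real.rpow_pos_of_pos (one_add_mul_pos hy (Ioo_subset_Icc_self hs)) _)
    fun s hs t ht hst => ?_
  have hs' := Ioo_subset_Icc_self hs
  have ht' := Ioo_subset_Icc_self ht
  have p1 := one_add_mul_pos hx hs'
  have p2 := one_add_mul_pos hx ht'
  have p3 := one_add_mul_pos hy hs'
  have p4 := one_add_mul_pos hy ht'
  rw [← Real.mul_rpow p2.le p3.le, ← Real.mul_rpow p1.le p4.le, mul_comm, mul_comm (1 + x * s)]
  exact Real.rpow_lt_rpow (mul_pos p3 p2).le (one_add_mul_mul_lt hxy hst) (neg_pos.2 ha)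

end

theorem mainTheorem6 (b c d e : ℝ) (hs : 0 < d + e - b - c) (hb : 0 < b) (hc : 0 < c)
    (hmin : min b c < min d e) :
    -- the monotonicity of the ratio, with the existence of the two analytic continuations
    (∀ a δ : ℝ, 0 < δ →
      IsHyp3F2 a b c d e (hyp3F2 a b c d e) ∧
      IsHyp3F2 a (b + δ) (c + δ) (d + δ) (e + δ) (hyp3F2 a (b + δ) (c + δ) (d + δ) (e + δ)) ∧
      (∀ x : ℝ, -1 < x → realHyp3F2 a b c d e (-x) ≠ 0) ∧
      (0 < a → StrictAntiOn
        (fun x : ℝ => realHyp3F2 a (b + δ) (c + δ) (d + δ) (e + δ) (-x) /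
          realHyp3F2 a b c d e (-x)) (Set.Ioi (-1))) ∧
      (a < 0 → StrictMonoOn
        (fun x : ℝ => realHyp3F2 a (b + δ) (c + δ) (d + δ) (e + δ) (-x) /
          realHyp3F2 a b c d e (-x)) (Set.Ioi (-1)))) ∧
    -- the two-sided bound for `a = 1`
    (∀ x : ℝ, 0 < x → 1 / (1 + x * (b * c / (d * e))) < realHyp3F2 1 b c d e (-x)) ∧
    (1 < b → 1 < c → ∀ x : ℝ, 0 < x →
      realHyp3F2 1 b c d e (-x) < 1 / (1 + x * ((b - 1) * (c - 1) / ((d - 1) * (e - 1))))) ∧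
    -- the lower bound for `σ ≥ 1`
    (∀ σ x : ℝ, 1 ≤ σ → -1 < x → x ≠ 0 →
      1 / (1 + x * (b * c / (d * e))) ^ σ < realHyp3F2 σ b c d e (-x)) ∧
    -- the upper bound for `0 < σ ≤ 1`
    (1 < b → 1 < c → ∀ σ x : ℝ, 0 < σ → σ ≤ 1 → 0 < x →
      realHyp3F2 σ b c d e (-x) <
        1 / (1 + x * ((b - 1) * (c - 1) / ((d - 1) * (e - 1)))) ^ σ) := by
  obtain ⟨hd, he⟩ := lt_min_iff.1 ((lt_min hb hc).trans hmin)
  have lower : ∀ σ x : ℝ, 1 ≤ σ → -1 < x → x ≠ 0 →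
      1 / (1 + x * (b * c / (d * e))) ^ σ < realHyp3F2 σ b c d e (-x) := fun σ x hσ hx hx0 =>
    one_div_one_add_rpow_lt_realHyp3F2 hs hb hc hmin (by linarith) hx hx0
  have upper : 1 < b → 1 < c → ∀ σ x : ℝ, 0 < σ → σ ≤ 1 → 0 < x → realHyp3F2 σ b c d e (-x) <
      1 / (1 + x * ((b - 1) * (c - 1) / ((d - 1) * (e - 1)))) ^ σ :=
    fun hb1 hc1 σ x hσ hσ1 hx => realHyp3F2_lt_one_div_one_add_rpow hs hb1 hc1 hmin hσ hσ1 hx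
  refine ⟨fun a δ hδ => ?_, fun x hx => ?_, fun hb1 hc1 x hx => ?_, lower, upper⟩
  · obtain ⟨ρ, hρ⟩ := exists_isMomentMeasure hb hc hmin hs
    have := hρ.isFiniteMeasure
    have h0 := hρ.ne_zero hb hc hd he
    have H0 := isHyp3F2_stieltjes hb hc hd he hρ a le_rfl
    simp only [add_zero] at H0
    have M0 := momentFactor_pos hb hc hd he le_rfl
    have Mδ := momentFactor_pos hb hc hd he hδ.le
    have e0 : ∀ x : ℝ, -1 < x → realHyp3F2 a b c d e (-x) =
        (momentFactor b c d e 0)⁻¹ * ∫ s, (1 + x * s) ^ (-a) ∂ρ := fun x hx => by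
      simpa using realHyp3F2_neg_eq_integral hb hc hd he hρ a le_rfl hx
    have eδ := fun (x : ℝ) (hx : -1 < x) =>
      realHyp3F2_neg_eq_integral hb hc hd he hρ a hδ.le hx
    have P : ∀ x : ℝ, -1 < x → 0 < ∫ s, (1 + x * s) ^ (-a) ∂ρ := fun x hx => by
      simpa using integral_one_add_rpow_pos h0 hρ.ae_mem hx le_rfl (-a)
    have Q : ∀ x : ℝ, -1 < x → 0 < realHyp3F2 a b c d e (-x) := fun x hx => by
      rw [e0 x hx]
      exact mul_pos (inv_pos.2 M0) (P x hx)
    -- The common constant of both sides once the inequality between the ratios is cross-multiplied.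
    have K := mul_pos (inv_pos.2 M0) (inv_pos.2 Mδ)
    refine ⟨isHyp3F2_hyp3F2 ⟨_, H0⟩,
      isHyp3F2_hyp3F2 ⟨_, isHyp3F2_stieltjes hb hc hd he hρ a hδ.le⟩,
      fun x hx => (Q x hx).ne', fun ha x hx y hy hxy => ?_, fun ha x hx y hy hxy => ?_⟩
    · have h := mul_lt_mul_of_pos_left
        (integral_rpow_mul_one_add_rpow_lt_of_pos h0 hρ.ae_mem hρ.ae_ne hδ ha hx hxy) K
      change _ / _ < _ / _
      rw [div_lt_div_iff₀ (Q y hy) (Q x hx), e0 x hx, e0 y hy, eδ x hx, eδ y hy]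
      linarith
    · have h := mul_lt_mul_of_pos_left
        (integral_rpow_mul_one_add_rpow_lt_of_neg h0 hρ.ae_mem hρ.ae_ne hδ ha hx hxy) K
      change _ / _ < _ / _
      rw [div_lt_div_iff₀ (Q x hx) (Q y hy), e0 x hx, e0 y hy, eδ x hx, eδ y hy]
      linarith
  · simpa using lower 1 x le_rfl (by linarith) hx.ne'
  · simpa using upper hb1 hc1 1 x one_pos le_rfl hx
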